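/- Let $M_r$ denote the complex $r\times r$ matrices; "positive" ($\ge 0$) means positive semidefinite, and $\operatorname{im}$ denotes the image of a matrix. Write $S\in M_m\otimes M_n$ uniquely as $S=\sum_{i,j}E_{ij}\otimes S_{ij}$ with $E_{ij}$ the matrix units of $M_m$ and $S_{ij}\in M_n$, and put $\operatorname{tr}_A S=\sum_i S_{ii}$, $\operatorname{tr}_B S=\sum_{i,j}\operatorname{tr}(S_{ij})E_{ij}$. A positive $S$ is called $B$-independent (respectively $B$-orthogonal) if $S=\sum_{\gamma=1}^p A_\gamma\otimes B_\gamma$ for some $p\ge 0$ and positive $A_\gamma\in M_m$, $B_\gamma\in M_n$ such that the subspaces $\operatorname{im}B_1,\dots,\operatorname{im}B_p$ of $\mathbb C^n$ are independent, i.e. their sum is direct (respectively, are pairwise orthogonal). Let $0\le T\in M_m\otimes M_n$, let $T_B=\operatorname{tr}_A T$, let $T_B^{\#}$ be the Penrose pseudo-inverse of $T_B$, and let $\widetilde T=(I\otimes (T_B^{\#})^{1/2})\,T\,(I\otimes (T_B^{\#})^{1/2})$. The following are equivalent: (i) $T$ is $B$-independent; (ii) $\widetilde T$ is $B$-orthogonal;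 (iii) all the matrices $\widetilde T_{ij}$ ($1\le i,j\le m$) are normal and they mutually commute. If $T$ is $B$-independent, then there is a decomposition $T=\sum_{\gamma=1}^p A_\gamma\otimes B_\gamma$ with $A_1,\dots,A_p$ positive, distinct and of trace $1$, and with $B_1,\dots,B_p$ positive, nonzero and with independent images; it is unique up to the order of the terms. Explicitly, there are only finitely many families $\lambda=(\lambda_{ij})\ne 0$ of complex numbers whose joint eigenspace $\{x\in\mathbb C^n : \widetilde T_{ij}x=\lambda_{ij}x \text{ for all } i,j\}$ is nonzero. If $Q_1,\dots,Q_p$ are the orthogonal projections onto the joint eigenspaces of these families (each family listed once), then this unique decomposition is given by $$B_\gamma=T_B^{1/2}Q_\gamma T_B^{1/2},\qquad A_\gamma=\frac1{\operatorname{tr}Q_\gamma}\operatorname{tr}_B\big((I\otimes Q_\gamma)\,\widetilde T\,(I\otimes Q_\gamma)\big),$$ and $\sum_\gamma Q_\gamma$ is the orthogonal projection onto $\operatorname{im}T_B$. -/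

import Mathlib

open scoped Kronecker ComplexOrder

noncomputable section

/-! Elements of `M_m ⊗ M_n` are matrices indexed by `Fin m × Fin n`; the elementary tensor
`A ⊗ B` is the Kronecker product `A ⊗ₖ B`. -/

namespace BIndep

/-- The image of a matrix, as a subspace of the Hilbert space `ℂⁿ`. -/
def image {n : ℕ} (A : Matrix (Fin n) (Fin n) ℂ) : Submodule ℂ (EuclideanSpace ℂ (Fin n)) :=
  LinearMap.range (Matrix.toEuclideanLin A)

/-- The matrix of the orthogonal projection onto a subspace of `ℂⁿ`. -/
def projMatrix {n : ℕ} (V : Submodule ℂ (EuclideanSpace ℂ (Fin n))) :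
    Matrix (Fin n) (Fin n) ℂ :=
  Matrix.toEuclideanLin.symm (V.starProjection : EuclideanSpace ℂ (Fin n) →ₗ[ℂ] _)

/-- The Penrose pseudo-inverse of a positive matrix: the functional calculus inverts
the nonzero eigenvalues and keeps the eigenvalue `0` (recall `(0 : ℝ)⁻¹ = 0`). -/
def pinv {n : ℕ} (A : Matrix (Fin n) (Fin n) ℂ) : Matrix (Fin n) (Fin n) ℂ :=
  cfc (fun x : ℝ => x⁻¹) A

open scoped MatrixOrder in
/-- The positive square root of a positive matrix. -/
def msqrt {n : ℕ} (A : Matrix (Fin n) (Fin n) ℂ) : Matrix (Fin n) (Fin n) ℂ :=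
  CFC.sqrt A

/-- The block `S_ij`, so that `S = ∑ E_ij ⊗ S_ij`. -/
def block {m n : ℕ} (S : Matrix (Fin m × Fin n) (Fin m × Fin n) ℂ) (i j : Fin m) :
    Matrix (Fin n) (Fin n) ℂ :=
  Matrix.of fun k l => S (i, k) (j, l)

/-- The partial trace over the first factor, `tr_A S = ∑ S_ii`. -/
def traceA {m n : ℕ} (S : Matrix (Fin m × Fin n) (Fin m × Fin n) ℂ) :
    Matrix (Fin n) (Fin n) ℂ :=
  ∑ i, block S i i

/-- The partial trace over the second factor, `tr_B S = ∑ tr(S_ij) E_ij`. -/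
def traceB {m n : ℕ} (S : Matrix (Fin m × Fin n) (Fin m × Fin n) ℂ) :
    Matrix (Fin m) (Fin m) ℂ :=
  Matrix.of fun i j => (block S i j).trace

/-- The filtered matrix `(I ⊗ (T_B^#)^{1/2}) T (I ⊗ (T_B^#)^{1/2})`, where `T_B = tr_A T`. -/
def filtered {m n : ℕ} (T : Matrix (Fin m × Fin n) (Fin m × Fin n) ℂ) :
    Matrix (Fin m × Fin n) (Fin m × Fin n) ℂ :=
  ((1 : Matrix (Fin m) (Fin m) ℂ) ⊗ₖ msqrt (pinv (traceA T))) * T *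
    ((1 : Matrix (Fin m) (Fin m) ℂ) ⊗ₖ msqrt (pinv (traceA T)))

/-- `T` is a finite sum of `A_γ ⊗ B_γ` with all `A_γ`, `B_γ` positive and the images of
the `B_γ` independent. -/
def BIndependent {m n : ℕ} (T : Matrix (Fin m × Fin n) (Fin m × Fin n) ℂ) : Prop :=
  ∃ (p : ℕ) (A : Fin p → Matrix (Fin m) (Fin m) ℂ) (B : Fin p → Matrix (Fin n) (Fin n) ℂ),
    (∀ γ, (A γ).PosSemidef) ∧ (∀ γ, (B γ).PosSemidef) ∧
    iSupIndep (fun γ => image (B γ)) ∧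
    T = ∑ γ, A γ ⊗ₖ B γ

/-- `T` is a finite sum of `A_γ ⊗ B_γ` with all `A_γ`, `B_γ` positive and the images of
the `B_γ` pairwise orthogonal. -/
def BOrthogonal {m n : ℕ} (T : Matrix (Fin m × Fin n) (Fin m × Fin n) ℂ) : Prop :=
  ∃ (p : ℕ) (A : Fin p → Matrix (Fin m) (Fin m) ℂ) (B : Fin p → Matrix (Fin n) (Fin n) ℂ),
    (∀ γ, (A γ).PosSemidef) ∧ (∀ γ, (B γ).PosSemidef) ∧
    (∀ γ δ, γ ≠ δ → image (B γ) ⟂ image (B δ)) ∧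
    T = ∑ γ, A γ ⊗ₖ B γ

/-- `T = ∑ A_γ ⊗ B_γ` with the `A_γ` positive, of unit trace and distinct, and the `B_γ`
positive, nonzero and with independent images. -/
def IsCanonicalDecomposition {m n : ℕ} (T : Matrix (Fin m × Fin n) (Fin m × Fin n) ℂ) {p : ℕ}
    (A : Fin p → Matrix (Fin m) (Fin m) ℂ) (B : Fin p → Matrix (Fin n) (Fin n) ℂ) : Prop :=
  (∀ γ, (A γ).PosSemidef) ∧ (∀ γ, (A γ).trace = 1) ∧ Function.Injective A ∧
  (∀ γ, (B γ).PosSemidef) ∧ (∀ γ, B γ ≠ 0) ∧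
  iSupIndep (fun γ => image (B γ)) ∧
  T = ∑ γ, A γ ⊗ₖ B γ

/-- The joint eigenspace `{x | S_ij x = L_ij x for all i, j}` of the blocks of `S`. -/
def jointEigenspace {m n : ℕ} (S : Matrix (Fin m × Fin n) (Fin m × Fin n) ℂ)
    (L : Matrix (Fin m) (Fin m) ℂ) : Submodule ℂ (EuclideanSpace ℂ (Fin n)) :=
  ⨅ (i : Fin m) (j : Fin m),
    Module.End.eigenspace (Matrix.toEuclideanLin (block S i j)) (L i j)

/-- The families `L = (L_ij)` of joint eigenvalues of the blocks of `S`, excluding the family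
that is identically zero. -/
def nonzeroJointEigenvalues {m n : ℕ} (S : Matrix (Fin m × Fin n) (Fin m × Fin n) ℂ) :
    Set (Matrix (Fin m) (Fin m) ℂ) :=
  {L | L ≠ 0 ∧ jointEigenspace S L ≠ ⊥}

/-- `T_B^{1/2} Q T_B^{1/2}`. -/
def canonicalB {m n : ℕ} (T : Matrix (Fin m × Fin n) (Fin m × Fin n) ℂ)
    (Q : Matrix (Fin n) (Fin n) ℂ) : Matrix (Fin n) (Fin n) ℂ :=
  msqrt (traceA T) * Q * msqrt (traceA T)

/-- `(tr Q)⁻¹ tr_B ((I ⊗ Q) S (I ⊗ Q))` for the filtered matrix `S` of `T`. -/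
def canonicalA {m n : ℕ} (T : Matrix (Fin m × Fin n) (Fin m × Fin n) ℂ)
    (Q : Matrix (Fin n) (Fin n) ℂ) : Matrix (Fin m) (Fin m) ℂ :=
  (Q.trace)⁻¹ • traceB (((1 : Matrix (Fin m) (Fin m) ℂ) ⊗ₖ Q) * filtered T *
    ((1 : Matrix (Fin m) (Fin m) ℂ) ⊗ₖ Q))

end BIndep

end

namespace BIndep

open Matrix

variable {m n : ℕ}

/-! ### Positive matrices -/

/-! Write `H` for `T_B`, `P` for the projection onto its image, `W` for the square root of its
pseudo-inverse, and `S = (I ⊗ W) T (I ⊗ W)`.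

Suppose `T = ∑ A_γ ⊗ B_γ` with independent images, scaled so that `∑ B_γ = H`. The matrices `C_γ = W
B_γ W` then sum to `P`, so `∑_γ C_γ (C_δ - δ_{γδ}) = 0`. Multiplied by `H^{1/2}`, the `γ`-th term
lands in the image of `B_γ`; independence kills each term, and the `C_γ` are mutually orthogonal
projections (`conj_mul_conj_of_iSupIndep`). Hence `S = ∑ A_γ ⊗ C_γ`, and its blocks commute.

Conversely, `S_ij* = S_ji`, so commuting blocks are automatically normal and simultaneously
diagonalizable (`iSup_jointEigenspace_eq_top`). This gives `S = ∑ L_γ ⊗ Q_γ` over the nonzero joint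
eigenvalues. From `tr_A S = P` follow `∑ Q_γ = P` and `tr L_γ = 1`. Conjugation by `H^{1/2}` returns
to `T`, since positivity confines the blocks of `T` to the image of `H`.

Uniqueness: in any canonical decomposition the `A_γ` are exactly the nonzero joint eigenvalues of
`S`, the `C_γ` are the eigenprojections, and `B_γ = H^{1/2} C_γ H^{1/2}`. -/

theorem mul_eq_zero_of_trace_eq_zero {ι κ : Type*} [Fintype ι] [Fintype κ]
    {A : Matrix ι ι ℂ} (hA : A.PosSemidef) (N : Matrix ι κ ℂ)
    (h : (Nᴴ * A * N).trace = 0) : A * N = 0 := by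
  classical
  obtain ⟨Y, rfl⟩ : ∃ Y : Matrix ι ι ℂ, A = Yᴴ * Y := by
    open scoped MatrixOrder in
    exact CStarAlgebra.nonneg_iff_eq_star_mul_self.mp hA.nonneg
  have : ((Y * N)ᴴ * (Y * N)).trace = 0 := by
    rw [← h]
    simp only [conjTranspose_mul, Matrix.mul_assoc]
  rw [trace_conjTranspose_mul_self_eq_zero_iff] at this
  rw [Matrix.mul_assoc, this, Matrix.mul_zero]

/-- The traces of `Nᴴ * B a * N` are nonnegative with sum zero, so each of them vanishes. -/
theorem mul_eq_zero_of_sum_mul_eq_zero {ι κ α : Type*} [Fintype ι] [Fintype κ] [Fintype α]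
    {B : α → Matrix ι ι ℂ} (hB : ∀ a, (B a).PosSemidef) (N : Matrix ι κ ℂ)
    (h : (∑ a, B a) * N = 0) (a : α) : B a * N = 0 := by
  apply mul_eq_zero_of_trace_eq_zero (hB a)
  have hsum : ∑ a, (Nᴴ * B a * N).trace = 0 := by
    rw [← trace_sum, ← Matrix.sum_mul, ← Matrix.mul_sum, Matrix.mul_assoc, h, Matrix.mul_zero,
      trace_zero]
  exact (Finset.sum_eq_zero_iff_of_nonneg fun a _ =>
    ((hB a).conjTranspose_mul_mul_same N).trace_nonneg).1 hsum a (Finset.mem_univ a)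

/-- A positive matrix of trace zero is zero, so normalizing by the trace loses nothing even with
`0⁻¹ = 0`. -/
theorem smul_trace_inv_smul {ι : Type*} [Fintype ι] {A : Matrix ι ι ℂ} (hA : A.PosSemidef) :
    A.trace • (A.trace⁻¹ • A) = A := by
  by_cases h : A.trace = 0
  · rw [(hA.trace_eq_zero_iff).1 h]
    simp
  · rw [smul_smul, mul_inv_cancel₀ h, one_smul]

theorem trace_ne_zero_of_idempotent {ι : Type*} [Fintype ι] {Q : Matrix ι ι ℂ}
    (hQ : Qᴴ = Q) (h2 : Q * Q = Q) (h0 : Q ≠ 0) : Q.trace ≠ 0 := by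
  intro h
  apply h0
  rw [← trace_conjTranspose_mul_self_eq_zero_iff, hQ, h2, h]

/-! ### Square roots and the support projection of a positive matrix -/

theorem msqrt_posSemidef (A : Matrix (Fin n) (Fin n) ℂ) : (msqrt A).PosSemidef := by
  open scoped MatrixOrder in
  exact (CFC.sqrt_nonneg A).posSemidef

theorem msqrt_mul_msqrt {A : Matrix (Fin n) (Fin n) ℂ} (hA : A.PosSemidef) :
    msqrt A * msqrt A = A := by
  open scoped MatrixOrder in
  exact CFC.sqrt_mul_sqrt_self A hA.nonneg

theorem msqrt_unique {A B : Matrix (Fin n) (Fin n) ℂ} (h : B * B = A) (hB : B.PosSemidef) :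
    msqrt A = B := by
  open scoped MatrixOrder in
  exact CFC.sqrt_unique h hB.nonneg

/-- The spectrum is finite, hence discrete, so even `x ↦ x⁻¹` is admissible in the functional
calculus. -/
theorem spectrum_continuousOn (A : Matrix (Fin n) (Fin n) ℂ) (f : ℝ → ℝ) :
    ContinuousOn f (spectrum ℝ A) :=
  A.finite_real_spectrum.continuousOn f

theorem cfc_posSemidef (A : Matrix (Fin n) (Fin n) ℂ) {f : ℝ → ℝ} (hf : ∀ x, 0 ≤ f x) :
    (cfc f A).PosSemidef := by
  open scoped MatrixOrder in
  exact (cfc_nonneg fun x _ => hf x).posSemidef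

theorem spectrum_nonneg {A : Matrix (Fin n) (Fin n) ℂ} (hA : A.PosSemidef) {x : ℝ}
    (hx : x ∈ spectrum ℝ A) : 0 ≤ x := by
  open scoped MatrixOrder in
  exact spectrum_nonneg_of_nonneg hA.nonneg hx

theorem msqrt_eq_cfc {A : Matrix (Fin n) (Fin n) ℂ} (hA : A.PosSemidef) :
    msqrt A = cfc Real.sqrt A := by
  apply msqrt_unique _ (cfc_posSemidef A Real.sqrt_nonneg)
  rw [← cfc_mul _ _ A (spectrum_continuousOn A _) (spectrum_continuousOn A _)]
  have : cfc (fun x => √x * √x) A = cfc (fun x : ℝ => x) A :=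
    cfc_congr fun x hx => Real.mul_self_sqrt (spectrum_nonneg hA hx)
  rw [this]
  exact cfc_id' ℝ A hA.isHermitian

theorem msqrt_pinv_eq_cfc {A : Matrix (Fin n) (Fin n) ℂ} (hA : A.PosSemidef) :
    msqrt (pinv A) = cfc (fun x : ℝ => √(x⁻¹)) A := by
  apply msqrt_unique _ (cfc_posSemidef A fun x => Real.sqrt_nonneg _)
  rw [← cfc_mul _ _ A (spectrum_continuousOn A _) (spectrum_continuousOn A _)]
  exact cfc_congr fun x hx => Real.mul_self_sqrt (inv_nonneg.2 (spectrum_nonneg hA hx))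

/-- The orthogonal projection onto the image of a positive matrix. -/
noncomputable def support (A : Matrix (Fin n) (Fin n) ℂ) : Matrix (Fin n) (Fin n) ℂ :=
  msqrt A * msqrt (pinv A)

theorem msqrt_pinv_mul_msqrt {A : Matrix (Fin n) (Fin n) ℂ} (hA : A.PosSemidef) :
    msqrt (pinv A) * msqrt A = support A := by
  rw [support, msqrt_eq_cfc hA, msqrt_pinv_eq_cfc hA]
  exact cfc_commute_cfc _ _ A

theorem support_mul_msqrt {A : Matrix (Fin n) (Fin n) ℂ} (hA : A.PosSemidef) :
    support A * msqrt A = msqrt A := by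
  rw [support, msqrt_pinv_eq_cfc hA, msqrt_eq_cfc hA,
    ← cfc_mul _ _ A (spectrum_continuousOn A _) (spectrum_continuousOn A _),
    ← cfc_mul _ _ A (spectrum_continuousOn A _) (spectrum_continuousOn A _)]
  refine cfc_congr fun x hx => ?_
  rcases (spectrum_nonneg hA hx).eq_or_lt with rfl | h
  · simp
  · have : √x ≠ 0 := (Real.sqrt_pos.2 h).ne'
    simp [Real.sqrt_inv, this]

theorem support_mul_msqrt_pinv {A : Matrix (Fin n) (Fin n) ℂ} (hA : A.PosSemidef) :
    support A * msqrt (pinv A) = msqrt (pinv A) := by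
  rw [support, msqrt_pinv_eq_cfc hA, msqrt_eq_cfc hA,
    ← cfc_mul _ _ A (spectrum_continuousOn A _) (spectrum_continuousOn A _),
    ← cfc_mul _ _ A (spectrum_continuousOn A _) (spectrum_continuousOn A _)]
  refine cfc_congr fun x hx => ?_
  rcases (spectrum_nonneg hA hx).eq_or_lt with rfl | h
  · simp
  · have : √x ≠ 0 := (Real.sqrt_pos.2 h).ne'
    simp [Real.sqrt_inv, this]

theorem conjTranspose_support {A : Matrix (Fin n) (Fin n) ℂ} (hA : A.PosSemidef) :
    (support A)ᴴ = support A := by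
  rw [← msqrt_pinv_mul_msqrt hA, conjTranspose_mul, (msqrt_posSemidef _).isHermitian.eq,
    (msqrt_posSemidef _).isHermitian.eq, msqrt_pinv_mul_msqrt hA, support]

theorem msqrt_mul_support {A : Matrix (Fin n) (Fin n) ℂ} (hA : A.PosSemidef) :
    msqrt A * support A = msqrt A := by
  have := congrArg conjTranspose (support_mul_msqrt hA)
  rwa [conjTranspose_mul, conjTranspose_support hA, (msqrt_posSemidef _).isHermitian.eq] at this

theorem support_mul_self {A : Matrix (Fin n) (Fin n) ℂ} (hA : A.PosSemidef) :
    support A * A = A := by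
  nth_rw 2 [← msqrt_mul_msqrt hA]
  rw [← Matrix.mul_assoc, support_mul_msqrt hA, msqrt_mul_msqrt hA]

theorem mul_support_self {A : Matrix (Fin n) (Fin n) ℂ} (hA : A.PosSemidef) :
    A * support A = A := by
  nth_rw 1 [← msqrt_mul_msqrt hA]
  rw [Matrix.mul_assoc, msqrt_mul_support hA, msqrt_mul_msqrt hA]

theorem self_mul_msqrt_pinv {A : Matrix (Fin n) (Fin n) ℂ} (hA : A.PosSemidef) :
    A * msqrt (pinv A) = msqrt A := by
  nth_rw 1 [← msqrt_mul_msqrt hA]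
  rw [Matrix.mul_assoc]
  exact msqrt_mul_support hA

/-! ### Images -/

theorem mem_image {A : Matrix (Fin n) (Fin n) ℂ} {x : EuclideanSpace ℂ (Fin n)} :
    x ∈ image A ↔ ∃ y : Fin n → ℂ, A *ᵥ y = x.ofLp := by
  constructor
  · rintro ⟨y, rfl⟩
    exact ⟨y.ofLp, rfl⟩
  · rintro ⟨y, hy⟩
    exact ⟨WithLp.toLp 2 y, by ext i; exact congrFun hy i⟩

theorem iSupIndep_image_iff {p : ℕ} {B : Fin p → Matrix (Fin n) (Fin n) ℂ} :
    iSupIndep (fun γ => image (B γ)) ↔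
      ∀ x : Fin p → Fin n → ℂ, ∑ γ, B γ *ᵥ x γ = 0 → ∀ γ, B γ *ᵥ x γ = 0 := by
  rw [iSupIndep_iff_finsetSum_eq_zero_imp_eq_zero]
  constructor
  · intro h x hx γ
    have := h Finset.univ (fun γ => WithLp.toLp 2 (B γ *ᵥ x γ))
      (fun γ _ => mem_image.2 ⟨x γ, rfl⟩)
      (by rw [← WithLp.toLp_sum, hx, WithLp.toLp_zero]) γ (Finset.mem_univ γ)
    simpa using this
  · intro h s v hv hs γ hγ
    -- Extending the family by zero outside `s` reduces finite subfamilies to the full index set.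
    have hy : ∀ γ, ∃ y : Fin n → ℂ, B γ *ᵥ y = if γ ∈ s then (v γ).ofLp else 0 := by
      intro γ
      split_ifs with hγ
      · exact mem_image.1 (hv γ hγ)
      · exact ⟨0, mulVec_zero _⟩
    choose y hy using hy
    have := h y (by
      simp only [hy, Finset.sum_ite_mem, Finset.univ_inter]
      rw [← WithLp.ofLp_sum, hs, WithLp.ofLp_zero]) γ
    rw [hy, if_pos hγ] at this
    simpa using this

theorem mul_eq_zero_of_iSupIndep {p : ℕ} {B : Fin p → Matrix (Fin n) (Fin n) ℂ}
    (h : iSupIndep (fun γ => image (B γ))) (X : Fin p → Matrix (Fin n) (Fin n) ℂ)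
    (hX : ∑ γ, B γ * X γ = 0) (γ : Fin p) : B γ * X γ = 0 := by
  ext i j
  have := iSupIndep_image_iff.1 h (fun γ => X γ *ᵥ Pi.single j 1) (by
    simp only [mulVec_mulVec]
    rw [← sum_mulVec, hX, zero_mulVec]) γ
  rw [mulVec_mulVec] at this
  simpa using congrFun this i

theorem image_orthogonal_iff {A B : Matrix (Fin n) (Fin n) ℂ} (hA : Aᴴ = A) :
    image A ⟂ image B ↔ A * B = 0 := by
  have key : ∀ x y : Fin n → ℂ,
      inner ℂ (WithLp.toLp 2 (A *ᵥ x)) (WithLp.toLp 2 (B *ᵥ y)) = star x ⬝ᵥ (A * B) *ᵥ y := by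
    intro x y
    rw [EuclideanSpace.inner_toLp_toLp, star_mulVec, hA, dotProduct_comm, ← dotProduct_mulVec,
      mulVec_mulVec]
  rw [Submodule.isOrtho_iff_inner_eq]
  constructor
  · intro h
    ext i j
    have := h (WithLp.toLp 2 (A *ᵥ Pi.single i 1)) (mem_image.2 ⟨_, rfl⟩)
      (WithLp.toLp 2 (B *ᵥ Pi.single j 1)) (mem_image.2 ⟨_, rfl⟩)
    rw [key] at this
    simpa [← Pi.single_star] using this
  · rintro h _ ⟨x, rfl⟩ _ ⟨y, rfl⟩
    exact (key x.ofLp y.ofLp).trans (by simp [h])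

/-- For `w ∈ V`, `⟪Q x, w⟫ = ⟪x, Q w⟫ = ⟪x, w⟫`, so `x - Q x` is orthogonal to `V`. -/
theorem projMatrix_eq {V : Submodule ℂ (EuclideanSpace ℂ (Fin n))} {Q : Matrix (Fin n) (Fin n) ℂ}
    (hQ : Qᴴ = Q) (hV : ∀ x ∈ V, Q *ᵥ x.ofLp = x.ofLp)
    (hmem : ∀ x : Fin n → ℂ, WithLp.toLp 2 (Q *ᵥ x) ∈ V) : projMatrix V = Q := by
  rw [projMatrix, LinearEquiv.symm_apply_eq]
  ext1 x
  refine Submodule.eq_starProjection_of_mem_of_inner_eq_zero (hmem x.ofLp) fun w hw => ?_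
  have h1 : inner ℂ (toEuclideanLin Q x) w = inner ℂ x (toEuclideanLin Q w) :=
    isSymmetric_toEuclideanLin_iff.2 hQ x w
  have h2 : toEuclideanLin Q w = w := congrArg (WithLp.toLp 2) (hV w hw)
  rw [h2] at h1
  rw [inner_sub_left, sub_eq_zero]
  exact h1.symm

theorem projMatrix_mulVec_of_mem {V : Submodule ℂ (EuclideanSpace ℂ (Fin n))}
    {x : EuclideanSpace ℂ (Fin n)} (hx : x ∈ V) : projMatrix V *ᵥ x.ofLp = x.ofLp := by
  have : toEuclideanLin (projMatrix V) x = x := by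
    rw [projMatrix, LinearEquiv.apply_symm_apply]
    exact V.starProjection_eq_self_iff.2 hx
  exact congrArg WithLp.ofLp this

theorem projMatrix_mulVec_mem (V : Submodule ℂ (EuclideanSpace ℂ (Fin n))) (x : Fin n → ℂ) :
    WithLp.toLp 2 (projMatrix V *ᵥ x) ∈ V := by
  have : toEuclideanLin (projMatrix V) (WithLp.toLp 2 x) ∈ V := by
    rw [projMatrix, LinearEquiv.apply_symm_apply]
    exact V.starProjection_apply_mem _
  exact this

theorem projMatrix_mulVec_of_mem_orthogonal {V : Submodule ℂ (EuclideanSpace ℂ (Fin n))}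
    {x : EuclideanSpace ℂ (Fin n)} (hx : x ∈ Vᗮ) : projMatrix V *ᵥ x.ofLp = 0 := by
  have : toEuclideanLin (projMatrix V) x = 0 := by
    rw [projMatrix, LinearEquiv.apply_symm_apply]
    exact V.starProjection_apply_eq_zero_iff.2 hx
  exact congrArg WithLp.ofLp this

theorem projMatrix_mul_projMatrix (V : Submodule ℂ (EuclideanSpace ℂ (Fin n))) :
    projMatrix V * projMatrix V = projMatrix V := by
  refine ext_of_mulVec_single fun j => ?_
  rw [← mulVec_mulVec]
  exact projMatrix_mulVec_of_mem (projMatrix_mulVec_mem V _)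

theorem conjTranspose_projMatrix (V : Submodule ℂ (EuclideanSpace ℂ (Fin n))) :
    (projMatrix V)ᴴ = projMatrix V := by
  have : (toEuclideanLin (projMatrix V)).IsSymmetric := by
    rw [projMatrix, LinearEquiv.apply_symm_apply]
    exact V.starProjection_isSymmetric
  exact isSymmetric_toEuclideanLin_iff.1 this

theorem projMatrix_image {A : Matrix (Fin n) (Fin n) ℂ} (hA : A.PosSemidef) :
    projMatrix (image A) = support A := by
  refine projMatrix_eq (conjTranspose_support hA) ?_ fun x => ?_
  · intro x hx
    obtain ⟨y, hy⟩ := mem_image.1 hx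
    rw [← hy, mulVec_mulVec, support_mul_self hA]
  · refine mem_image.2 ⟨(msqrt (pinv A) * msqrt (pinv A)) *ᵥ x, ?_⟩
    rw [mulVec_mulVec, ← Matrix.mul_assoc, self_mul_msqrt_pinv hA, support]

/-! ### Blocks and partial traces -/

theorem block_ext {S S' : Matrix (Fin m × Fin n) (Fin m × Fin n) ℂ}
    (h : ∀ i j, block S i j = block S' i j) : S = S' := by
  ext ⟨i, k⟩ ⟨j, l⟩
  exact congrFun (congrFun (h i j) k) l

theorem block_one_kronecker_mul (X : Matrix (Fin n) (Fin n) ℂ)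
    (S : Matrix (Fin m × Fin n) (Fin m × Fin n) ℂ) (i j : Fin m) :
    block (((1 : Matrix (Fin m) (Fin m) ℂ) ⊗ₖ X) * S) i j = X * block S i j := by
  ext k l
  simp [block, Matrix.mul_apply, Fintype.sum_prod_type, Matrix.one_apply]

theorem block_mul_one_kronecker (X : Matrix (Fin n) (Fin n) ℂ)
    (S : Matrix (Fin m × Fin n) (Fin m × Fin n) ℂ) (i j : Fin m) :
    block (S * ((1 : Matrix (Fin m) (Fin m) ℂ) ⊗ₖ X)) i j = block S i j * X := by
  ext k l
  simp [block, Matrix.mul_apply, Fintype.sum_prod_type, Matrix.one_apply]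

theorem block_kronecker (A : Matrix (Fin m) (Fin m) ℂ) (B : Matrix (Fin n) (Fin n) ℂ)
    (i j : Fin m) : block (A ⊗ₖ B) i j = A i j • B := by
  ext k l
  simp [block]

theorem block_sum {α : Type*} (s : Finset α)
    (S : α → Matrix (Fin m × Fin n) (Fin m × Fin n) ℂ) (i j : Fin m) :
    block (∑ a ∈ s, S a) i j = ∑ a ∈ s, block (S a) i j := by
  ext k l
  simp [block, Matrix.sum_apply]

theorem block_sum_kronecker {p : ℕ} (A : Fin p → Matrix (Fin m) (Fin m) ℂ)
    (B : Fin p → Matrix (Fin n) (Fin n) ℂ) (i j : Fin m) :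
    block (∑ γ, A γ ⊗ₖ B γ) i j = ∑ γ, A γ i j • B γ := by
  simp only [block_sum, block_kronecker]

theorem conjTranspose_block {S : Matrix (Fin m × Fin n) (Fin m × Fin n) ℂ} (hS : Sᴴ = S)
    (i j : Fin m) : (block S i j)ᴴ = block S j i := by
  ext k l
  exact congrFun (congrFun hS (j, k)) (i, l)

theorem trace_traceA (S : Matrix (Fin m × Fin n) (Fin m × Fin n) ℂ) :
    (traceA S).trace = S.trace := by
  rw [traceA, trace_sum]
  simp [Matrix.trace, block, Fintype.sum_prod_type]

theorem traceA_conj (X Y : Matrix (Fin n) (Fin n) ℂ)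
    (S : Matrix (Fin m × Fin n) (Fin m × Fin n) ℂ) :
    traceA (((1 : Matrix (Fin m) (Fin m) ℂ) ⊗ₖ X) * S * ((1 : Matrix (Fin m) (Fin m) ℂ) ⊗ₖ Y)) =
      X * traceA S * Y := by
  simp only [traceA, block_mul_one_kronecker, block_one_kronecker_mul, Matrix.mul_sum,
    Matrix.sum_mul]

theorem traceA_sum_kronecker {p : ℕ} (A : Fin p → Matrix (Fin m) (Fin m) ℂ)
    (B : Fin p → Matrix (Fin n) (Fin n) ℂ) :
    traceA (∑ γ, A γ ⊗ₖ B γ) = ∑ γ, (A γ).trace • B γ := by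
  simp only [traceA, block_sum_kronecker, Matrix.trace, Finset.sum_smul, Matrix.diag]
  exact Finset.sum_comm

theorem traceB_kronecker (A : Matrix (Fin m) (Fin m) ℂ) (B : Matrix (Fin n) (Fin n) ℂ) :
    traceB (A ⊗ₖ B) = B.trace • A := by
  ext i j
  simp [traceB, block_kronecker, trace_smul, mul_comm]

theorem traceA_posSemidef {S : Matrix (Fin m × Fin n) (Fin m × Fin n) ℂ} (hS : S.PosSemidef) :
    (traceA S).PosSemidef :=
  posSemidef_sum _ fun i _ => hS.submatrix fun k => (i, k)

theorem one_kronecker_conjTranspose (X : Matrix (Fin n) (Fin n) ℂ) :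
    ((1 : Matrix (Fin m) (Fin m) ℂ) ⊗ₖ X)ᴴ = 1 ⊗ₖ Xᴴ := by
  rw [conjTranspose_kronecker, conjTranspose_one]

/-- The compression of `T` by `I ⊗ (1 - P)` has trace `tr ((1 - P) T_B (1 - P)) = 0`, and positivity
turns this into `T (I ⊗ (1 - P)) = 0`. -/
theorem block_mul_support {T : Matrix (Fin m × Fin n) (Fin m × Fin n) ℂ} (hT : T.PosSemidef)
    (i j : Fin m) : block T i j * support (traceA T) = block T i j := by
  have hH := traceA_posSemidef hT
  have h0 : T * ((1 : Matrix (Fin m) (Fin m) ℂ) ⊗ₖ (1 - support (traceA T))) = 0 := by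
    apply mul_eq_zero_of_trace_eq_zero hT
    rw [one_kronecker_conjTranspose, ← trace_traceA, traceA_conj, Matrix.mul_assoc,
      Matrix.mul_sub, mul_support_self hH, Matrix.mul_one, sub_self, Matrix.mul_zero, trace_zero]
  have h1 := block_mul_one_kronecker (1 - support (traceA T)) T i j
  rw [h0, Matrix.mul_sub, Matrix.mul_one] at h1
  exact (sub_eq_zero.1 h1.symm).symm

theorem support_mul_block {T : Matrix (Fin m × Fin n) (Fin m × Fin n) ℂ} (hT : T.PosSemidef)
    (i j : Fin m) : support (traceA T) * block T i j = block T i j := by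
  have := congrArg conjTranspose (block_mul_support hT j i)
  rwa [conjTranspose_mul, conjTranspose_support (traceA_posSemidef hT),
    conjTranspose_block hT.isHermitian] at this

/-! ### The filtered matrix -/

theorem block_filtered (T : Matrix (Fin m × Fin n) (Fin m × Fin n) ℂ) (i j : Fin m) :
    block (filtered T) i j = msqrt (pinv (traceA T)) * block T i j * msqrt (pinv (traceA T)) := by
  rw [filtered, block_mul_one_kronecker, block_one_kronecker_mul]

theorem filtered_posSemidef {T : Matrix (Fin m × Fin n) (Fin m × Fin n) ℂ} (hT : T.PosSemidef) :
    (filtered T).PosSemidef := by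
  have := hT.mul_mul_conjTranspose_same
    ((1 : Matrix (Fin m) (Fin m) ℂ) ⊗ₖ msqrt (pinv (traceA T)))
  rwa [one_kronecker_conjTranspose, (msqrt_posSemidef _).isHermitian.eq] at this

theorem traceA_filtered {T : Matrix (Fin m × Fin n) (Fin m × Fin n) ℂ} (hT : T.PosSemidef) :
    traceA (filtered T) = support (traceA T) := by
  have hH := traceA_posSemidef hT
  rw [filtered, traceA_conj, Matrix.mul_assoc, self_mul_msqrt_pinv hH, msqrt_pinv_mul_msqrt hH]

theorem support_mul_block_filtered {T : Matrix (Fin m × Fin n) (Fin m × Fin n) ℂ}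
    (hT : T.PosSemidef) (i j : Fin m) :
    support (traceA T) * block (filtered T) i j = block (filtered T) i j := by
  rw [block_filtered, ← Matrix.mul_assoc, ← Matrix.mul_assoc,
    support_mul_msqrt_pinv (traceA_posSemidef hT)]

/-- Filtering is reversible: the square roots combine to the support projection on both sides, which
fixes the blocks of `T`. -/
theorem msqrt_mul_block_filtered_mul_msqrt {T : Matrix (Fin m × Fin n) (Fin m × Fin n) ℂ}
    (hT : T.PosSemidef) (i j : Fin m) :
    msqrt (traceA T) * block (filtered T) i j * msqrt (traceA T) = block T i j := by
  have hH := traceA_posSemidef hT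
  rw [block_filtered, Matrix.mul_assoc, Matrix.mul_assoc, msqrt_pinv_mul_msqrt hH,
    Matrix.mul_assoc, block_mul_support hT, ← Matrix.mul_assoc]
  exact support_mul_block hT i j

/-! ### Independent images become orthogonal after filtering -/

theorem mul_support_of_sum_eq {p : ℕ} {B : Fin p → Matrix (Fin n) (Fin n) ℂ}
    (hB : ∀ γ, (B γ).PosSemidef) {H : Matrix (Fin n) (Fin n) ℂ} (hH : H.PosSemidef)
    (hsum : ∑ γ, B γ = H) (γ : Fin p) : B γ * support H = B γ := by
  have := mul_eq_zero_of_sum_mul_eq_zero hB (1 - support H)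
    (by rw [hsum, Matrix.mul_sub, mul_support_self hH, Matrix.mul_one, sub_self]) γ
  rw [Matrix.mul_sub, Matrix.mul_one] at this
  exact (sub_eq_zero.1 this).symm

theorem support_mul_of_sum_eq {p : ℕ} {B : Fin p → Matrix (Fin n) (Fin n) ℂ}
    (hB : ∀ γ, (B γ).PosSemidef) {H : Matrix (Fin n) (Fin n) ℂ} (hH : H.PosSemidef)
    (hsum : ∑ γ, B γ = H) (γ : Fin p) : support H * B γ = B γ := by
  have := congrArg conjTranspose (mul_support_of_sum_eq hB hH hsum γ)
  rwa [conjTranspose_mul, conjTranspose_support hH, (hB γ).isHermitian.eq] at this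

/-- The key step from independence to orthogonality. The weights `a γ` will be the traces of the `A
γ`, and may vanish. -/
theorem conj_mul_conj_of_iSupIndep {p : ℕ} {B : Fin p → Matrix (Fin n) (Fin n) ℂ}
    (hB : ∀ γ, (B γ).PosSemidef) (hind : iSupIndep fun γ => image (B γ))
    {a : Fin p → ℂ} (ha : ∀ γ, 0 ≤ a γ) {H W : Matrix (Fin n) (Fin n) ℂ} (hH : H.PosSemidef)
    (hsum : ∑ γ, a γ • B γ = H) (hW : W = msqrt (pinv H)) (γ δ : Fin p) :
    (W * (a γ • B γ) * W) * (W * (a δ • B δ) * W) =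
      if γ = δ then W * (a γ • B γ) * W else 0 := by
  have hP' := support_mul_of_sum_eq (fun γ => (hB γ).smul (ha γ)) hH hsum
  have hRW : ∀ X, msqrt H * (W * X) = support H * X := by
    intro X
    rw [hW, ← Matrix.mul_assoc, support]
  have hPW : support H * W = W := by rw [hW, support_mul_msqrt_pinv hH]
  set C : Fin p → Matrix (Fin n) (Fin n) ℂ := fun γ => W * (a γ • B γ) * W with hC
  change C γ * C δ = if γ = δ then C γ else 0
  have hCsum : ∀ X, (∑ γ, C γ) * (W * X) = W * X := by
    intro X
    rw [hC, ← Matrix.sum_mul, ← Matrix.mul_sum, hsum, Matrix.mul_assoc W H, hW,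
      self_mul_msqrt_pinv hH, msqrt_pinv_mul_msqrt hH, ← Matrix.mul_assoc, ← hW, hPW]
  -- `∑ γ, C γ * C δ - C δ = 0`, transported back to the `B γ`
  have key : ∀ γ, C γ * (C δ - if γ = δ then 1 else 0) = 0 := by
    have h0 : ∑ γ, C γ * (C δ - if γ = δ then 1 else 0) = 0 := by
      simp only [Matrix.mul_sub, Finset.sum_sub_distrib, mul_ite, Matrix.mul_one,
        Matrix.mul_zero, Finset.sum_ite_eq', Finset.mem_univ, if_true, ← Matrix.sum_mul]
      rw [sub_eq_zero]
      have := hCsum ((a δ • B δ) * W)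
      rwa [show W * (a δ • B δ * W) = C δ from (Matrix.mul_assoc _ _ _).symm] at this
    -- Multiplication by `H^{1/2}` places each term in the image of the corresponding `B γ`, where
    -- independence applies.
    have h1 : ∀ γ X, msqrt H * (C γ * X) = B γ * (a γ • (W * X)) := by
      intro γ X
      simp only [hC]
      rw [Matrix.mul_assoc, Matrix.mul_assoc, hRW, ← Matrix.mul_assoc, hP', Matrix.smul_mul,
        Matrix.mul_smul]
    intro γ
    have h2 := mul_eq_zero_of_iSupIndep hind
      (fun γ => a γ • (W * (C δ - if γ = δ then 1 else 0)))
      (by simp only [← h1, ← Matrix.mul_sum]; rw [h0, Matrix.mul_zero]) γ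
    rw [Matrix.mul_smul, ← Matrix.smul_mul] at h2
    simp only [hC] at h2 ⊢
    rw [Matrix.mul_assoc, Matrix.mul_assoc, h2, Matrix.mul_zero]
  have h3 := key γ
  rw [Matrix.mul_sub, sub_eq_zero] at h3
  rw [h3]
  split_ifs <;> simp

/-- `S = ∑ A_γ ⊗ C_γ` where the `C_γ` are mutually orthogonal projections. -/
structure IsProjDecomposition (S : Matrix (Fin m × Fin n) (Fin m × Fin n) ℂ) {p : ℕ}
    (A : Fin p → Matrix (Fin m) (Fin m) ℂ) (C : Fin p → Matrix (Fin n) (Fin n) ℂ) : Prop where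
  posSemidef : ∀ γ, (C γ).PosSemidef
  mul_eq : ∀ γ δ, C γ * C δ = if γ = δ then C γ else 0
  eq_sum : S = ∑ γ, A γ ⊗ₖ C γ

/-- The trace of `A γ` is moved to the second factor, so that these factors sum to `T_B` before
filtering. -/
theorem isProjDecomposition_filtered {T : Matrix (Fin m × Fin n) (Fin m × Fin n) ℂ}
    (hT : T.PosSemidef) {p : ℕ} {A : Fin p → Matrix (Fin m) (Fin m) ℂ}
    {B : Fin p → Matrix (Fin n) (Fin n) ℂ} (hA : ∀ γ, (A γ).PosSemidef)
    (hB : ∀ γ, (B γ).PosSemidef) (hind : iSupIndep fun γ => image (B γ))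
    (hsum : T = ∑ γ, A γ ⊗ₖ B γ) :
    IsProjDecomposition (filtered T) (fun γ => (A γ).trace⁻¹ • A γ)
      (fun γ => msqrt (pinv (traceA T)) * ((A γ).trace • B γ) * msqrt (pinv (traceA T))) where
  posSemidef γ := by
    have := ((hB γ).smul (hA γ).trace_nonneg).mul_mul_conjTranspose_same
      (msqrt (pinv (traceA T)))
    rwa [(msqrt_posSemidef _).isHermitian.eq] at this
  mul_eq γ δ := conj_mul_conj_of_iSupIndep hB hind (fun γ => (hA γ).trace_nonneg)
    (traceA_posSemidef hT) (by rw [← traceA_sum_kronecker, ← hsum]) rfl γ δ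
  eq_sum := by
    refine block_ext fun i j => ?_
    rw [block_filtered, block_sum_kronecker]
    conv_lhs => rw [hsum, block_sum_kronecker, ← hsum]
    rw [Matrix.mul_sum, Matrix.sum_mul]
    refine Finset.sum_congr rfl fun γ _ => ?_
    have := congrFun (congrFun (smul_trace_inv_smul (hA γ)) i) j
    simp only [Matrix.mul_smul, Matrix.smul_mul, smul_smul, Matrix.smul_apply,
      smul_eq_mul] at this ⊢
    rw [mul_comm, this]

theorem IsProjDecomposition.conjTranspose_eq {S : Matrix (Fin m × Fin n) (Fin m × Fin n) ℂ} {p : ℕ}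
    {A : Fin p → Matrix (Fin m) (Fin m) ℂ} {C : Fin p → Matrix (Fin n) (Fin n) ℂ}
    (h : IsProjDecomposition S A C) (γ : Fin p) : (C γ)ᴴ = C γ :=
  (h.posSemidef γ).isHermitian

theorem bOrthogonal_filtered {T : Matrix (Fin m × Fin n) (Fin m × Fin n) ℂ}
    (hT : T.PosSemidef) (h : BIndependent T) : BOrthogonal (filtered T) := by
  obtain ⟨p, A, B, hA, hB, hind, hsum⟩ := h
  have h := isProjDecomposition_filtered hT hA hB hind hsum
  refine ⟨p, _, _, fun γ => (hA γ).smul (inv_nonneg.2 (hA γ).trace_nonneg), h.posSemidef, ?_,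
    h.eq_sum⟩
  intro γ δ hne
  rw [image_orthogonal_iff (h.conjTranspose_eq γ), h.mul_eq, if_neg hne]

theorem commute_block_of_bOrthogonal {S : Matrix (Fin m × Fin n) (Fin m × Fin n) ℂ}
    (h : BOrthogonal S) (i j k l : Fin m) : Commute (block S i j) (block S k l) := by
  obtain ⟨p, A, B, -, hB, hort, rfl⟩ := h
  simp only [block_sum_kronecker]
  refine Commute.sum_left _ _ _ fun γ _ => Commute.sum_right _ _ _ fun δ _ => ?_
  refine Commute.smul_left (Commute.smul_right ?_ _) _
  rcases eq_or_ne γ δ with rfl | hne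
  · exact Commute.refl _
  · have h1 := (image_orthogonal_iff (hB γ).isHermitian).1 (hort γ δ hne)
    have h2 := (image_orthogonal_iff (hB δ).isHermitian).1 (hort δ γ hne.symm)
    exact h1.trans h2.symm

/-- The adjoint of a block is again a block, so normality is a special case of commutation. -/
theorem isStarNormal_block {S : Matrix (Fin m × Fin n) (Fin m × Fin n) ℂ} (hS : Sᴴ = S)
    (h : ∀ i j k l, Commute (block S i j) (block S k l)) (i j : Fin m) :
    IsStarNormal (block S i j) := by
  refine ⟨?_⟩
  rw [star_eq_conjTranspose, conjTranspose_block hS]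
  exact h j i i j

/-! ### Joint eigenspaces of the blocks -/

theorem mem_jointEigenspace {S : Matrix (Fin m × Fin n) (Fin m × Fin n) ℂ}
    {L : Matrix (Fin m) (Fin m) ℂ} {x : EuclideanSpace ℂ (Fin n)} :
    x ∈ jointEigenspace S L ↔ ∀ i j, block S i j *ᵥ x.ofLp = L i j • x.ofLp := by
  simp only [jointEigenspace, Submodule.mem_iInf, Module.End.mem_eigenspace_iff]
  exact forall₂_congr fun i j =>
    ⟨fun h => congrArg WithLp.ofLp h, fun h => congrArg (WithLp.toLp 2) h⟩

theorem inner_block_mulVec {S : Matrix (Fin m × Fin n) (Fin m × Fin n) ℂ} (hS : Sᴴ = S)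
    (i j : Fin m) (x y : EuclideanSpace ℂ (Fin n)) :
    inner ℂ (toEuclideanLin (block S i j) x) y = inner ℂ x (toEuclideanLin (block S j i) y) := by
  rw [← conjTranspose_block hS i j, toEuclideanLin_conjTranspose_eq_adjoint,
    LinearMap.adjoint_inner_right]

theorem conj_eigenvalue {S : Matrix (Fin m × Fin n) (Fin m × Fin n) ℂ} (hS : Sᴴ = S)
    {L : Matrix (Fin m) (Fin m) ℂ} {x : EuclideanSpace ℂ (Fin n)} (hx : x ∈ jointEigenspace S L)
    (h0 : x ≠ 0) (i j : Fin m) : star (L i j) = L j i := by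
  have h : ∀ i j, toEuclideanLin (block S i j) x = L i j • x := fun i j =>
    congrArg (WithLp.toLp 2) (mem_jointEigenspace.1 hx i j)
  have := inner_block_mulVec hS i j x x
  rw [h, h, inner_smul_left, inner_smul_right] at this
  exact mul_right_cancel₀ (inner_self_ne_zero.2 h0) this

/-- Comparing `⟪S_ij x, y⟫ = ⟪x, S_ji y⟫` on two joint eigenvectors, with `M_ji` the conjugate of
`M_ij`, forces `L = M` unless `⟪x, y⟫ = 0`. Commutation plays no role here. -/
theorem orthogonalFamily_jointEigenspace {S : Matrix (Fin m × Fin n) (Fin m × Fin n) ℂ}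
    (hS : Sᴴ = S) : OrthogonalFamily ℂ (fun L => jointEigenspace S L)
      fun L => (jointEigenspace S L).subtypeₗᵢ := by
  refine OrthogonalFamily.of_pairwise fun L M hne => ?_
  refine Submodule.isOrtho_iff_inner_eq.2 ?_
  intro x hx y hy
  by_cases h0 : y = 0
  · rw [h0, inner_zero_right]
  by_contra hxy
  refine hne (Matrix.ext fun i j => ?_)
  have h1 : toEuclideanLin (block S i j) x = L i j • x :=
    congrArg (WithLp.toLp 2) (mem_jointEigenspace.1 hx i j)
  have h2 : toEuclideanLin (block S j i) y = M j i • y :=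
    congrArg (WithLp.toLp 2) (mem_jointEigenspace.1 hy j i)
  have := inner_block_mulVec hS i j x y
  rw [h1, h2, inner_smul_left, inner_smul_right, ← conj_eigenvalue hS hy h0 i j] at this
  exact star_injective (mul_right_cancel₀ hxy this)

theorem finite_nonzeroJointEigenvalues {S : Matrix (Fin m × Fin n) (Fin m × Fin n) ℂ}
    (hS : Sᴴ = S) : (nonzeroJointEigenvalues S).Finite :=
  (WellFoundedGT.finite_ne_bot_of_iSupIndep
    (orthogonalFamily_jointEigenspace hS).independent).subset fun _ h => h.2

theorem iSup_jointEigenspace_eq_top {S : Matrix (Fin m × Fin n) (Fin m × Fin n) ℂ}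
    (hS : Sᴴ = S) (hcomm : ∀ i j k l, Commute (block S i j) (block S k l)) :
    ⨆ L, jointEigenspace S L = ⊤ := by
  -- the Hermitian and (rotated) skew-Hermitian parts of the blocks
  let D : Fin m × Fin m × Bool → Matrix (Fin n) (Fin n) ℂ := fun a =>
    bif a.2.2 then block S a.1 a.2.1 + block S a.2.1 a.1
    else Complex.I • (block S a.1 a.2.1 - block S a.2.1 a.1)
  have hD : ∀ a, (D a).IsHermitian := by
    rintro ⟨i, j, _ | _⟩
    · change (Complex.I • (block S i j - block S j i))ᴴ = Complex.I • (block S i j - block S j i)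
      rw [conjTranspose_smul, conjTranspose_sub, conjTranspose_block hS, conjTranspose_block hS,
        ← neg_sub, smul_neg, ← neg_smul]
      congr 1
      simp
    · change (block S i j + block S j i)ᴴ = block S i j + block S j i
      rw [conjTranspose_add, conjTranspose_block hS, conjTranspose_block hS, add_comm]
  have hDD : ∀ a b, Commute (D a) (D b) := by
    rintro ⟨i, j, _ | _⟩ ⟨k, l, _ | _⟩
    · exact (((hcomm _ _ _ _).sub_right (hcomm _ _ _ _)).sub_left
        ((hcomm _ _ _ _).sub_right (hcomm _ _ _ _))).smul_left _ |>.smul_right _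
    · exact (((hcomm _ _ _ _).add_right (hcomm _ _ _ _)).sub_left
        ((hcomm _ _ _ _).add_right (hcomm _ _ _ _))).smul_left _
    · exact (((hcomm _ _ _ _).sub_right (hcomm _ _ _ _)).add_left
        ((hcomm _ _ _ _).sub_right (hcomm _ _ _ _))).smul_right _
    · exact ((hcomm _ _ _ _).add_right (hcomm _ _ _ _)).add_left
        ((hcomm _ _ _ _).add_right (hcomm _ _ _ _))
  have htop := LinearMap.IsSymmetric.iSup_iInf_eq_top_of_commute
    (T := fun a => toEuclideanLin (D a))
    (fun a => isSymmetric_toEuclideanLin_iff.2 (hD a))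
    (fun a b _ => by
      change toEuclideanLin (D a) ∘ₗ toEuclideanLin (D b) =
        toEuclideanLin (D b) ∘ₗ toEuclideanLin (D a)
      ext1 x
      have := congrArg (fun M => WithLp.toLp 2 (M *ᵥ x.ofLp)) (hDD a b).eq
      simp only [← mulVec_mulVec] at this
      exact this)
  rw [eq_top_iff, ← htop]
  -- With `D₁ = S_ij + S_ji` and `D₀ = I (S_ij - S_ji)` one has `S_ij = (D₁ - I D₀) / 2`, which
  -- dictates the eigenvalue.
  refine iSup_le fun χ => le_iSup_of_le
    (Matrix.of fun i j => (χ (i, j, true) - Complex.I * χ (i, j, false)) / 2) fun x hx => ?_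
  rw [mem_jointEigenspace]
  intro i j
  rw [Submodule.mem_iInf] at hx
  have h1 : (block S i j + block S j i) *ᵥ x.ofLp = χ (i, j, true) • x.ofLp :=
    congrArg WithLp.ofLp (Module.End.mem_eigenspace_iff.1 (hx (i, j, true)))
  have h2 : (Complex.I • (block S i j - block S j i)) *ᵥ x.ofLp = χ (i, j, false) • x.ofLp :=
    congrArg WithLp.ofLp (Module.End.mem_eigenspace_iff.1 (hx (i, j, false)))
  have h3 : block S i j = (1 / 2 : ℂ) • ((block S i j + block S j i) -
      Complex.I • (Complex.I • (block S i j - block S j i))) := by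
    rw [smul_smul, Complex.I_mul_I]
    module
  rw [h3, smul_mulVec, sub_mulVec, smul_mulVec, h1, h2, of_apply]
  module

theorem ext_of_jointEigenspace {S : Matrix (Fin m × Fin n) (Fin m × Fin n) ℂ}
    (htop : ⨆ L, jointEigenspace S L = ⊤) {A B : Matrix (Fin n) (Fin n) ℂ}
    (h : ∀ L, ∀ x ∈ jointEigenspace S L, x ≠ 0 → A *ᵥ x.ofLp = B *ᵥ x.ofLp) : A = B := by
  refine toEuclideanLin.injective (LinearMap.ext fun x => ?_)
  have hx : x ∈ ⨆ L, jointEigenspace S L := htop ▸ Submodule.mem_top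
  induction hx using Submodule.iSup_induction' with
  | mem L x hx =>
    by_cases h0 : x = 0
    · simp [h0]
    · exact congrArg (WithLp.toLp 2) (h L x hx h0)
  | zero => simp
  | add x y _ _ hx hy => rw [map_add, map_add, hx, hy]

section Enumeration

variable {S : Matrix (Fin m × Fin n) (Fin m × Fin n) ℂ} {p : ℕ}
  {L : Fin p → Matrix (Fin m) (Fin m) ℂ}

theorem projMatrix_jointEigenspace_mulVec (hS : Sᴴ = S) (N M : Matrix (Fin m) (Fin m) ℂ)
    {x : EuclideanSpace ℂ (Fin n)} (hx : x ∈ jointEigenspace S M) :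
    projMatrix (jointEigenspace S N) *ᵥ x.ofLp = if N = M then x.ofLp else 0 := by
  split_ifs with h
  · exact projMatrix_mulVec_of_mem (h ▸ hx)
  · refine projMatrix_mulVec_of_mem_orthogonal ?_
    exact ((orthogonalFamily_jointEigenspace hS).isOrtho (Ne.symm h)).le hx

/-- A joint functional calculus. The zero family is not enumerated, whence `f 0 = 0`; entries `f L =
L i j` recover the blocks, and the indicator of `L ≠ 0` gives the sum of the projections. -/
theorem sum_projMatrix_mulVec (hS : Sᴴ = S) (hL : Function.Injective L)
    (hrange : Set.range L = nonzeroJointEigenvalues S) {f : Matrix (Fin m) (Fin m) ℂ → ℂ}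
    (hf : f 0 = 0) {M : Matrix (Fin m) (Fin m) ℂ} {x : EuclideanSpace ℂ (Fin n)}
    (hx : x ∈ jointEigenspace S M) (h0 : x ≠ 0) :
    (∑ γ, f (L γ) • projMatrix (jointEigenspace S (L γ))) *ᵥ x.ofLp = f M • x.ofLp := by
  simp only [sum_mulVec, smul_mulVec, projMatrix_jointEigenspace_mulVec hS _ M hx]
  by_cases hM : M = 0
  · rw [hM, hf, zero_smul]
    refine Finset.sum_eq_zero fun γ _ => ?_
    have : L γ ∈ nonzeroJointEigenvalues S := hrange ▸ Set.mem_range_self γ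
    rw [if_neg this.1, smul_zero]
  · have : M ∈ nonzeroJointEigenvalues S :=
      ⟨hM, fun h => h0 (by rwa [h, Submodule.mem_bot] at hx)⟩
    rw [← hrange] at this
    obtain ⟨γ, rfl⟩ := this
    simp [hL.eq_iff]

theorem isProjDecomposition_of_commute (hS : Sᴴ = S)
    (hcomm : ∀ i j k l, Commute (block S i j) (block S k l)) (hL : Function.Injective L)
    (hrange : Set.range L = nonzeroJointEigenvalues S) :
    IsProjDecomposition S L fun γ => projMatrix (jointEigenspace S (L γ)) where
  posSemidef γ := by
    have := posSemidef_conjTranspose_mul_self (projMatrix (jointEigenspace S (L γ)))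
    rwa [conjTranspose_projMatrix, projMatrix_mul_projMatrix] at this
  mul_eq γ δ := by
    split_ifs with h
    · rw [h, projMatrix_mul_projMatrix]
    · refine ext_of_mulVec_single fun j => ?_
      rw [← mulVec_mulVec, zero_mulVec]
      refine (projMatrix_jointEigenspace_mulVec hS _ _
        (projMatrix_mulVec_mem (jointEigenspace S (L δ)) _)).trans (if_neg (hL.ne h))
  eq_sum := by
    refine block_ext fun i j => ext_of_jointEigenspace (iSup_jointEigenspace_eq_top hS hcomm) ?_
    intro M x hx h0
    rw [block_sum_kronecker, mem_jointEigenspace.1 hx]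
    exact (sum_projMatrix_mulVec hS hL hrange (f := fun L => L i j) rfl hx h0).symm

/-- On the zero joint eigenspace `P = ∑ S_ii` vanishes; on any other, `P S_ij x = S_ij x` with a
nonzero eigenvalue gives `P x = x`. -/
theorem sum_projMatrix_eq {P : Matrix (Fin n) (Fin n) ℂ} (hS : Sᴴ = S)
    (hcomm : ∀ i j k l, Commute (block S i j) (block S k l)) (hL : Function.Injective L)
    (hrange : Set.range L = nonzeroJointEigenvalues S) (htr : traceA S = P)
    (hP : ∀ i j, P * block S i j = block S i j) :
    ∑ γ, projMatrix (jointEigenspace S (L γ)) = P := by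
  refine ext_of_jointEigenspace (iSup_jointEigenspace_eq_top hS hcomm) fun M x hx h0 => ?_
  have h1 := sum_projMatrix_mulVec hS hL hrange (f := fun L => if L = 0 then 0 else 1)
    (if_pos rfl) hx h0
  have hL0 : ∀ γ, L γ ≠ 0 := fun γ =>
    (show L γ ∈ nonzeroJointEigenvalues S from hrange ▸ Set.mem_range_self γ).1
  simp only [hL0, if_false, one_smul] at h1
  rw [h1]
  rw [mem_jointEigenspace] at hx
  split_ifs with hM
  · rw [← htr, traceA, sum_mulVec]
    simp [hx, hM]
  · obtain ⟨i, j, hij⟩ : ∃ i j, M i j ≠ 0 := by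
      by_contra! h
      exact hM (Matrix.ext h)
    have h2 := congrArg (· *ᵥ x.ofLp) (hP i j)
    simp only [← mulVec_mulVec, hx, mulVec_smul] at h2
    rw [one_smul, smul_right_injective _ hij h2]

end Enumeration

/-! ### Decompositions of the filtered matrix -/

theorem IsProjDecomposition.block_eq {S : Matrix (Fin m × Fin n) (Fin m × Fin n) ℂ} {p : ℕ}
    {A : Fin p → Matrix (Fin m) (Fin m) ℂ} {C : Fin p → Matrix (Fin n) (Fin n) ℂ}
    (h : IsProjDecomposition S A C) (i j : Fin m) : block S i j = ∑ γ, A γ i j • C γ := by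
  rw [h.eq_sum, block_sum_kronecker]

theorem IsProjDecomposition.mul_block {S : Matrix (Fin m × Fin n) (Fin m × Fin n) ℂ} {p : ℕ}
    {A : Fin p → Matrix (Fin m) (Fin m) ℂ} {C : Fin p → Matrix (Fin n) (Fin n) ℂ}
    (h : IsProjDecomposition S A C) (γ : Fin p) (i j : Fin m) :
    C γ * block S i j = A γ i j • C γ := by
  simp [h.block_eq, Matrix.mul_sum, h.mul_eq]

theorem IsProjDecomposition.block_mul {S : Matrix (Fin m × Fin n) (Fin m × Fin n) ℂ} {p : ℕ}
    {A : Fin p → Matrix (Fin m) (Fin m) ℂ} {C : Fin p → Matrix (Fin n) (Fin n) ℂ}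
    (h : IsProjDecomposition S A C) (γ : Fin p) (i j : Fin m) :
    block S i j * C γ = A γ i j • C γ := by
  simp [h.block_eq, Matrix.sum_mul, h.mul_eq]

/-- Evaluating `C γ * S_ij` at `x` in two ways gives `A γ i j • C γ x = M i j • C γ x`. -/
theorem IsProjDecomposition.mulVec_of_mem {S : Matrix (Fin m × Fin n) (Fin m × Fin n) ℂ} {p : ℕ}
    {A : Fin p → Matrix (Fin m) (Fin m) ℂ} {C : Fin p → Matrix (Fin n) (Fin n) ℂ}
    (h : IsProjDecomposition S A C) {M : Matrix (Fin m) (Fin m) ℂ} {x : EuclideanSpace ℂ (Fin n)}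
    (hx : x ∈ jointEigenspace S M) {γ : Fin p} (hne : A γ ≠ M) : C γ *ᵥ x.ofLp = 0 := by
  by_contra h0
  refine hne (Matrix.ext fun i j => ?_)
  have := congrArg (· *ᵥ x.ofLp) (h.mul_block γ i j)
  simp only [← mulVec_mulVec, mem_jointEigenspace.1 hx, mulVec_smul, smul_mulVec] at this
  exact (smul_left_injective ℂ h0 this).symm

theorem IsProjDecomposition.mem_jointEigenspace {S : Matrix (Fin m × Fin n) (Fin m × Fin n) ℂ}
    {p : ℕ} {A : Fin p → Matrix (Fin m) (Fin m) ℂ} {C : Fin p → Matrix (Fin n) (Fin n) ℂ}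
    (h : IsProjDecomposition S A C) (γ : Fin p) (x : Fin n → ℂ) :
    WithLp.toLp 2 (C γ *ᵥ x) ∈ jointEigenspace S (A γ) := by
  rw [BIndep.mem_jointEigenspace]
  intro i j
  rw [mulVec_mulVec, h.block_mul, smul_mulVec]

/-- On this eigenspace the other `C δ` vanish, leaving `A γ i j • C γ x = A γ i j • x`; a nonzero
entry can be cancelled. Thus `C γ` depends only on `S` and `A γ`. -/
theorem IsProjDecomposition.projMatrix_eq {S : Matrix (Fin m × Fin n) (Fin m × Fin n) ℂ} {p : ℕ}
    {A : Fin p → Matrix (Fin m) (Fin m) ℂ} {C : Fin p → Matrix (Fin n) (Fin n) ℂ}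
    (h : IsProjDecomposition S A C) (hA : Function.Injective A) {γ : Fin p} (h0 : A γ ≠ 0) :
    projMatrix (jointEigenspace S (A γ)) = C γ := by
  refine BIndep.projMatrix_eq (h.posSemidef γ).isHermitian (fun x hx => ?_)
    (h.mem_jointEigenspace γ)
  obtain ⟨i, j, hij⟩ : ∃ i j, A γ i j ≠ 0 := by
    by_contra! h
    exact h0 (Matrix.ext h)
  have h1 := BIndep.mem_jointEigenspace.1 hx i j
  rw [h.block_eq, sum_mulVec, Finset.sum_eq_single γ (fun δ _ hδ => by
    rw [smul_mulVec, h.mulVec_of_mem hx (hA.ne hδ), smul_zero]) (by simp), smul_mulVec] at h1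
  exact smul_right_injective _ hij h1

/-- If `M` is none of the `A γ`, every `C γ` kills its eigenvectors, hence so do all blocks, and `M
= 0`. -/
theorem IsProjDecomposition.range_eq {S : Matrix (Fin m × Fin n) (Fin m × Fin n) ℂ} {p : ℕ}
    {A : Fin p → Matrix (Fin m) (Fin m) ℂ} {C : Fin p → Matrix (Fin n) (Fin n) ℂ}
    (h : IsProjDecomposition S A C) (hA : ∀ γ, A γ ≠ 0) (hC : ∀ γ, C γ ≠ 0) :
    Set.range A = nonzeroJointEigenvalues S := by
  ext M
  constructor
  · rintro ⟨γ, rfl⟩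
    refine ⟨hA γ, fun hbot => hC γ (ext_of_mulVec_single fun j => ?_)⟩
    have := h.mem_jointEigenspace γ (Pi.single j 1)
    rw [hbot, Submodule.mem_bot] at this
    rw [zero_mulVec]
    exact congrArg WithLp.ofLp this
  · rintro ⟨hM, hbot⟩
    by_contra hrange
    obtain ⟨x, hx, hx0⟩ := (Submodule.ne_bot_iff _).1 hbot
    refine hM (Matrix.ext fun i j => ?_)
    have h1 := BIndep.mem_jointEigenspace.1 hx i j
    rw [h.block_eq, sum_mulVec, Finset.sum_eq_zero fun γ _ => by
      rw [smul_mulVec, h.mulVec_of_mem hx fun he => hrange ⟨γ, he⟩, smul_zero]] at h1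
    refine (smul_eq_zero.1 h1.symm).resolve_right fun h2 => hx0 ?_
    exact congrArg (WithLp.toLp 2) h2

theorem posSemidef_traceB {S : Matrix (Fin m × Fin n) (Fin m × Fin n) ℂ} (hS : S.PosSemidef) :
    (traceB S).PosSemidef := by
  have : traceB S = ∑ k, S.submatrix (fun i => (i, k)) fun i => (i, k) := by
    ext i j
    simp [traceB, block, Matrix.trace, Matrix.sum_apply]
  rw [this]
  exact posSemidef_sum _ fun k _ => hS.submatrix _

/-! ### Canonical decompositions: explicit form and uniqueness -/

section Canonical

variable {T : Matrix (Fin m × Fin n) (Fin m × Fin n) ℂ} {p : ℕ}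
  {A : Fin p → Matrix (Fin m) (Fin m) ℂ} {B C : Fin p → Matrix (Fin n) (Fin n) ℂ}

theorem IsProjDecomposition.canonicalA_eq (h : IsProjDecomposition (filtered T) A C) {γ : Fin p}
    (hC : C γ ≠ 0) : canonicalA T (C γ) = A γ := by
  have h1 : ((1 : Matrix (Fin m) (Fin m) ℂ) ⊗ₖ C γ) * filtered T *
      ((1 : Matrix (Fin m) (Fin m) ℂ) ⊗ₖ C γ) = A γ ⊗ₖ C γ := by
    refine block_ext fun i j => ?_
    rw [block_mul_one_kronecker, block_one_kronecker_mul, block_kronecker, h.mul_block,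
      Matrix.smul_mul, h.mul_eq, if_pos rfl]
  have h2 : C γ * C γ = C γ := by rw [h.mul_eq, if_pos rfl]
  rw [canonicalA, h1, traceB_kronecker, smul_smul,
    inv_mul_cancel₀ (trace_ne_zero_of_idempotent (h.conjTranspose_eq γ) h2 hC), one_smul]

theorem posSemidef_canonicalA (hT : T.PosSemidef) {Q : Matrix (Fin n) (Fin n) ℂ}
    (hQ : Q.PosSemidef) : (canonicalA T Q).PosSemidef := by
  refine (posSemidef_traceB ?_).smul (inv_nonneg.2 hQ.trace_nonneg)
  have := (filtered_posSemidef hT).mul_mul_conjTranspose_same ((1 : Matrix (Fin m) (Fin m) ℂ) ⊗ₖ Q)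
  rwa [one_kronecker_conjTranspose, hQ.isHermitian.eq] at this

theorem IsProjDecomposition.isCanonicalDecomposition (hT : T.PosSemidef)
    (h : IsProjDecomposition (filtered T) A C) (hA : Function.Injective A) (hC : ∀ γ, C γ ≠ 0)
    (hsum : ∑ γ, C γ = support (traceA T)) :
    IsCanonicalDecomposition T A fun γ => canonicalB T (C γ) := by
  have hH := traceA_posSemidef hT
  have hCP : ∀ γ, C γ * support (traceA T) = C γ := fun γ => by
    simp [← hsum, Matrix.mul_sum, h.mul_eq]
  have hPC : ∀ γ, support (traceA T) * C γ = C γ := fun γ => by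
    simp [← hsum, Matrix.sum_mul, h.mul_eq]
  have hWB : ∀ γ, msqrt (pinv (traceA T)) * canonicalB T (C γ) = C γ * msqrt (traceA T) := by
    intro γ
    rw [canonicalB, ← Matrix.mul_assoc, ← Matrix.mul_assoc, msqrt_pinv_mul_msqrt hH, hPC]
  refine ⟨fun γ => ?_, fun γ => ?_, hA, fun γ => ?_, fun γ h0 => hC γ ?_, ?_, ?_⟩
  · rw [← h.canonicalA_eq (hC γ)]
    exact posSemidef_canonicalA hT (h.posSemidef γ)
  -- Multiplying `∑ tr(A δ) C δ = P` by `C γ` gives `tr(A γ) C γ = C γ`.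
  · have h1 := congrArg (· * C γ) (traceA_filtered hT)
    simp only [h.eq_sum, traceA_sum_kronecker, hPC, Matrix.sum_mul, Matrix.smul_mul, h.mul_eq,
      smul_ite, smul_zero, Finset.sum_ite_eq', Finset.mem_univ, if_true] at h1
    exact smul_left_injective ℂ (hC γ) (by simpa using h1)
  · have := (h.posSemidef γ).mul_mul_conjTranspose_same (msqrt (traceA T))
    rwa [(msqrt_posSemidef _).isHermitian.eq] at this
  · have h1 := hWB γ
    rw [show canonicalB T (C γ) = 0 from h0, Matrix.mul_zero] at h1
    rw [← hCP γ, support, ← Matrix.mul_assoc, ← h1, Matrix.zero_mul]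
  · rw [iSupIndep_image_iff]
    intro x hx γ
    -- Applying `C γ * W` to the sum isolates its `γ`-th term, by orthogonality of the projections.
    have h1 : C γ *ᵥ (msqrt (pinv (traceA T)) *ᵥ ∑ δ, canonicalB T (C δ) *ᵥ x δ) =
        (C γ * msqrt (traceA T)) *ᵥ x γ := by
      rw [mulVec_sum, mulVec_sum, Finset.sum_eq_single γ]
      · rw [mulVec_mulVec _ (msqrt _), hWB, mulVec_mulVec, ← Matrix.mul_assoc, h.mul_eq, if_pos rfl]
      · intro δ _ hδ
        rw [mulVec_mulVec _ (msqrt _), hWB, mulVec_mulVec, ← Matrix.mul_assoc, h.mul_eq, if_neg hδ.symm,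
          Matrix.zero_mul, zero_mulVec]
      · simp
    rw [hx, mulVec_zero, mulVec_zero] at h1
    rw [canonicalB, Matrix.mul_assoc, ← mulVec_mulVec, ← h1, mulVec_zero]
  · refine block_ext fun i j => ?_
    rw [block_sum_kronecker, ← msqrt_mul_block_filtered_mul_msqrt hT, h.block_eq, Matrix.mul_sum,
      Matrix.sum_mul]
    simp only [canonicalB, Matrix.mul_smul, Matrix.smul_mul]

theorem IsCanonicalDecomposition.ne_zero (h : IsCanonicalDecomposition T A B) (γ : Fin p) :
    A γ ≠ 0 := by
  intro h0
  have := h.2.1 γ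
  rw [h0, trace_zero] at this
  exact zero_ne_one this

theorem IsCanonicalDecomposition.isProjDecomposition (hT : T.PosSemidef)
    (h : IsCanonicalDecomposition T A B) :
    IsProjDecomposition (filtered T) A
      fun γ => msqrt (pinv (traceA T)) * B γ * msqrt (pinv (traceA T)) := by
  obtain ⟨hA, htr, -, hB, -, hind, hsum⟩ := h
  simpa only [htr, inv_one, one_smul] using isProjDecomposition_filtered hT hA hB hind hsum

theorem IsCanonicalDecomposition.canonicalB_eq (hT : T.PosSemidef)
    (h : IsCanonicalDecomposition T A B) (γ : Fin p) :
    canonicalB T (msqrt (pinv (traceA T)) * B γ * msqrt (pinv (traceA T))) = B γ := by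
  obtain ⟨hA, htr, -, hB, -, hind, hsum⟩ := h
  have hH := traceA_posSemidef hT
  have hBsum : ∑ γ, B γ = traceA T := by
    rw [hsum, traceA_sum_kronecker]
    simp only [htr, one_smul]
  rw [canonicalB, Matrix.mul_assoc, Matrix.mul_assoc, msqrt_pinv_mul_msqrt hH,
    Matrix.mul_assoc, mul_support_of_sum_eq hB hH hBsum, ← Matrix.mul_assoc]
  exact support_mul_of_sum_eq hB hH hBsum γ

theorem IsCanonicalDecomposition.filtered_ne_zero (hT : T.PosSemidef)
    (h : IsCanonicalDecomposition T A B) (γ : Fin p) :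
    msqrt (pinv (traceA T)) * B γ * msqrt (pinv (traceA T)) ≠ 0 := by
  intro h0
  have := h.canonicalB_eq hT γ
  rw [h0, canonicalB, Matrix.mul_zero, Matrix.zero_mul] at this
  exact h.2.2.2.2.1 γ this.symm

theorem IsCanonicalDecomposition.range_eq (hT : T.PosSemidef)
    (h : IsCanonicalDecomposition T A B) :
    Set.range A = nonzeroJointEigenvalues (filtered T) :=
  (h.isProjDecomposition hT).range_eq h.ne_zero (h.filtered_ne_zero hT)

theorem IsCanonicalDecomposition.eq_canonicalB (hT : T.PosSemidef)
    (h : IsCanonicalDecomposition T A B) (γ : Fin p) :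
    B γ = canonicalB T (projMatrix (jointEigenspace (filtered T) (A γ))) := by
  rw [(h.isProjDecomposition hT).projMatrix_eq h.2.2.1 (h.ne_zero γ), h.canonicalB_eq hT]

/-- Both families `A`, `A'` enumerate the nonzero joint eigenvalues injectively, which defines `σ`;
each `B γ` is a function of `T` and `A γ`. -/
theorem IsCanonicalDecomposition.unique (hT : T.PosSemidef) (h : IsCanonicalDecomposition T A B)
    {q : ℕ} {A' : Fin q → Matrix (Fin m) (Fin m) ℂ} {B' : Fin q → Matrix (Fin n) (Fin n) ℂ}
    (h' : IsCanonicalDecomposition T A' B') :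
    ∃ σ : Fin p ≃ Fin q, ∀ γ, A' (σ γ) = A γ ∧ B' (σ γ) = B γ := by
  let σ : Fin p ≃ Fin q := (Equiv.ofInjective A h.2.2.1).trans
    ((Equiv.setCongr ((h.range_eq hT).trans (h'.range_eq hT).symm)).trans
      (Equiv.ofInjective A' h'.2.2.1).symm)
  have hσ : ∀ γ, A' (σ γ) = A γ := fun γ => Equiv.apply_ofInjective_symm h'.2.2.1 _
  exact ⟨σ, fun γ => ⟨hσ γ, by rw [h.eq_canonicalB hT, h'.eq_canonicalB hT, hσ]⟩⟩

theorem IsCanonicalDecomposition.bIndependent (h : IsCanonicalDecomposition T A B) :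
    BIndependent T :=
  ⟨p, A, B, h.1, h.2.2.2.1, h.2.2.2.2.2.1, h.2.2.2.2.2.2⟩

/-- The explicit decomposition, when the blocks of the filtered matrix commute. -/
theorem isCanonicalDecomposition_of_commute (hT : T.PosSemidef)
    (hcomm : ∀ i j k l, Commute (block (filtered T) i j) (block (filtered T) k l))
    {L : Fin p → Matrix (Fin m) (Fin m) ℂ} (hL : Function.Injective L)
    (hrange : Set.range L = nonzeroJointEigenvalues (filtered T)) :
    IsCanonicalDecomposition T
      (fun γ => canonicalA T (projMatrix (jointEigenspace (filtered T) (L γ))))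
      (fun γ => canonicalB T (projMatrix (jointEigenspace (filtered T) (L γ)))) ∧
    ∑ γ, projMatrix (jointEigenspace (filtered T) (L γ)) = projMatrix (image (traceA T)) := by
  have hS := (filtered_posSemidef hT).isHermitian.eq
  have hsum := sum_projMatrix_eq hS hcomm hL hrange (traceA_filtered hT)
    (support_mul_block_filtered hT)
  have h := isProjDecomposition_of_commute hS hcomm hL hrange
  have h0 : ∀ γ, projMatrix (jointEigenspace (filtered T) (L γ)) ≠ 0 := by
    intro γ hγ
    have : L γ ∈ nonzeroJointEigenvalues (filtered T) := hrange ▸ Set.mem_range_self γ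
    obtain ⟨x, hx, hx0⟩ := (Submodule.ne_bot_iff _).1 this.2
    have := projMatrix_mulVec_of_mem hx
    rw [hγ, zero_mulVec] at this
    exact hx0 (congrArg (WithLp.toLp 2) this.symm)
  refine ⟨?_, hsum.trans (projMatrix_image (traceA_posSemidef hT)).symm⟩
  -- The explicit `A_γ` is the joint eigenvalue `L γ` itself.
  have hA := funext fun γ => h.canonicalA_eq (h0 γ)
  rw [hA]
  exact h.isCanonicalDecomposition hT hL h0 hsum

theorem exists_enumeration (hT : T.PosSemidef) :
    ∃ (p : ℕ) (L : Fin p → Matrix (Fin m) (Fin m) ℂ), Function.Injective L ∧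
      Set.range L = nonzeroJointEigenvalues (filtered T) := by
  have := (finite_nonzeroJointEigenvalues
    (filtered_posSemidef hT).isHermitian.eq).to_subtype
  obtain ⟨p, ⟨e⟩⟩ := Finite.exists_equiv_fin (nonzeroJointEigenvalues (filtered T))
  refine ⟨p, fun γ => (e.symm γ).1, Subtype.val_injective.comp e.symm.injective, ?_⟩
  exact (e.symm.surjective.range_comp Subtype.val).trans Subtype.range_coe

end Canonical

end BIndep

/-! ### The main theorem -/

theorem mainTheorem1 (m n : ℕ) (T : Matrix (Fin m × Fin n) (Fin m × Fin n) ℂ)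
    (hT : T.PosSemidef) :
    (BIndep.BIndependent T ↔ BIndep.BOrthogonal (BIndep.filtered T)) ∧
    (BIndep.BOrthogonal (BIndep.filtered T) ↔
      (∀ i j, IsStarNormal (BIndep.block (BIndep.filtered T) i j)) ∧
      (∀ i j k l, Commute (BIndep.block (BIndep.filtered T) i j)
        (BIndep.block (BIndep.filtered T) k l))) ∧
    (BIndep.BIndependent T →
      -- existence of the decomposition
      (∃ (p : ℕ) (A : Fin p → Matrix (Fin m) (Fin m) ℂ) (B : Fin p → Matrix (Fin n) (Fin n) ℂ),
        BIndep.IsCanonicalDecomposition T A B) ∧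
      -- uniqueness, up to the order of the terms
      (∀ (p q : ℕ) (A : Fin p → Matrix (Fin m) (Fin m) ℂ) (B : Fin p → Matrix (Fin n) (Fin n) ℂ)
        (A' : Fin q → Matrix (Fin m) (Fin m) ℂ) (B' : Fin q → Matrix (Fin n) (Fin n) ℂ),
        BIndep.IsCanonicalDecomposition T A B → BIndep.IsCanonicalDecomposition T A' B' →
        ∃ σ : Fin p ≃ Fin q, ∀ γ, A' (σ γ) = A γ ∧ B' (σ γ) = B γ) ∧
      -- the explicit form, for every enumeration of the nonzero joint eigenvalues
      (BIndep.nonzeroJointEigenvalues (BIndep.filtered T)).Finite ∧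
      (∀ (p : ℕ) (L : Fin p → Matrix (Fin m) (Fin m) ℂ)
        (Q : Fin p → Matrix (Fin n) (Fin n) ℂ),
        Function.Injective L →
        Set.range L = BIndep.nonzeroJointEigenvalues (BIndep.filtered T) →
        (∀ γ, Q γ = BIndep.projMatrix (BIndep.jointEigenspace (BIndep.filtered T) (L γ))) →
        BIndep.IsCanonicalDecomposition T
          (fun γ => BIndep.canonicalA T (Q γ)) (fun γ => BIndep.canonicalB T (Q γ)) ∧
        ∑ γ, Q γ = BIndep.projMatrix (BIndep.image (BIndep.traceA T)))) := by
  have hS := (BIndep.filtered_posSemidef hT).isHermitian.eq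
  have hcan : (∀ i j k l, Commute (BIndep.block (BIndep.filtered T) i j)
      (BIndep.block (BIndep.filtered T) k l)) →
      ∃ (p : ℕ) (A : Fin p → Matrix (Fin m) (Fin m) ℂ) (B : Fin p → Matrix (Fin n) (Fin n) ℂ),
        BIndep.IsCanonicalDecomposition T A B := fun hcomm =>
    let ⟨p, _, hL, hrange⟩ := BIndep.exists_enumeration hT
    ⟨p, _, _, (BIndep.isCanonicalDecomposition_of_commute hT hcomm hL hrange).1⟩
  have hind : (∀ i j k l, Commute (BIndep.block (BIndep.filtered T) i j)
      (BIndep.block (BIndep.filtered T) k l)) → BIndep.BIndependent T := fun hcomm =>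
    let ⟨_, _, _, h⟩ := hcan hcomm
    h.bIndependent
  refine ⟨⟨BIndep.bOrthogonal_filtered hT,
      fun h => hind (BIndep.commute_block_of_bOrthogonal h)⟩,
    ⟨fun h => ⟨BIndep.isStarNormal_block hS (BIndep.commute_block_of_bOrthogonal h),
        BIndep.commute_block_of_bOrthogonal h⟩,
      fun h => BIndep.bOrthogonal_filtered hT (hind h.2)⟩, fun h => ?_⟩
  have hcomm := BIndep.commute_block_of_bOrthogonal (BIndep.bOrthogonal_filtered hT h)
  refine ⟨hcan hcomm, fun p q A B A' B' hAB hAB' => hAB.unique hT hAB',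
    BIndep.finite_nonzeroJointEigenvalues hS, fun p L Q hL hrange hQ => ?_⟩
  obtain rfl : Q = _ := funext hQ
  exact BIndep.isCanonicalDecomposition_of_commute hT hcomm hL hrange
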